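/- Let $\mathfrak k$ be a finite-dimensional nilpotent real Lie algebra which is 3-step nilpotent, meaning that its nilpotency class is exactly $3$: $[\mathfrak k,[\mathfrak k,[\mathfrak k,\mathfrak k]]]=0$ and $[\mathfrak k,[\mathfrak k,\mathfrak k]]\neq 0$. Assume that the center $\mathcal Z(\mathfrak k)$ is 1-dimensional. Let $\mathcal C_2\mathfrak k=\{X\in\mathfrak k\mid[\mathfrak k,[\mathfrak k,X]]=0\}$ be the second center of $\mathfrak k$. A nilpotent Lie algebra $\mathfrak k$ with 1-dimensional center is said to be of type $(A_+)$ if either $\mathcal C_2\mathfrak k$ is a maximal abelian subalgebra of $\mathfrak k$ or $\mathcal C_2\mathfrak k=\mathfrak k$. For $\xi\in\mathfrak k^*$ let $B_\xi(X,Y)=\xi([X,Y])$, and let $\mathcal O_\xi=\{\xi\circ\varphi\mid\varphi\in\mathrm{Ad}(G)\}\subseteq\mathfrak k^*$ be its coadjoint orbit, where $\mathrm{Ad}(G)$ is the group of automorphisms of $\mathfrak k$ generated by the operators $\exp(\operatorname{ad}X)$, $X\in\mathfrak k$. Its dimension is $\dim\mathcal O_\xi=\operatorname{rank}B_\xi$.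 A coadjoint orbit is generic if it has maximal dimension among all coadjoint orbits, and it is flat if it is an affine subspace of $\mathfrak k^*$. A polarization at $\xi$ is a subalgebra of $\mathfrak k$ that is maximal among the linear subspaces $W\subseteq\mathfrak k$ with $\xi([W,W])=0$. Then $\mathfrak k$ is of type $(A_+)$ if and only if every generic coadjoint orbit of $\mathfrak k$ is flat and $\mathcal C_2\mathfrak k$ is a polarization at every point of every generic coadjoint orbit. -/

import Mathlib

/-- The second center `C₂ 𝔤 = {X | [𝔤, [𝔤, X]] = 0}` of a Lie algebra. -/
def secondCenter (K 𝔤 : Type*) [Field K] [LieRing 𝔤] [LieAlgebra K 𝔤] : LieIdeal K 𝔤 where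
  carrier := {X | ∀ Y Z : 𝔤, ⁅Y, ⁅Z, X⁆⁆ = 0}
  add_mem' := by
    intro a b ha hb Y Z
    rw [lie_add, lie_add, ha Y Z, hb Y Z, add_zero]
  zero_mem' := by
    intro Y Z
    rw [lie_zero, lie_zero]
  smul_mem' := by
    intro c X hX Y Z
    rw [lie_smul, lie_smul, hX Y Z, smul_zero]
  lie_mem := by
    intro W X hX Y Z
    rw [hX Z W, lie_zero]

/-- The second center, viewed as a Lie subalgebra. -/
def secondCenterSubalgebra (K 𝔤 : Type*) [Field K] [LieRing 𝔤] [LieAlgebra K 𝔤] :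
    LieSubalgebra K 𝔤 :=
  (secondCenter K 𝔤).toLieSubalgebra

/-- A maximal abelian subalgebra: maximal, for inclusion, among the abelian subalgebras. -/
def IsMaximalAbelian {K 𝔤 : Type*} [Field K] [LieRing 𝔤] [LieAlgebra K 𝔤]
    (𝔪 : LieSubalgebra K 𝔤) : Prop :=
  Maximal (fun 𝔞 : LieSubalgebra K 𝔤 => IsLieAbelian 𝔞) 𝔪

/-- Lie algebras of type (A₊): nilpotent with one-dimensional center, and such that the second
center either is a maximal abelian subalgebra or is the whole algebra. -/
def IsTypeAPlus (K 𝔤 : Type*) [Field K] [LieRing 𝔤] [LieAlgebra K 𝔤] : Prop :=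
  LieRing.IsNilpotent 𝔤 ∧ Module.finrank K (LieAlgebra.center K 𝔤) = 1 ∧
    (IsMaximalAbelian (secondCenterSubalgebra K 𝔤) ∨ secondCenterSubalgebra K 𝔤 = ⊤)

/-- `exp (ad X) = ∑ i, (ad X) ^ i / i!`. When `ad X` is nilpotent (in particular, for every `X` in
a nilpotent Lie algebra), the terms with `i ≥ nilpotencyClass (ad X)` vanish, so that this finite
sum is the whole exponential series. -/
noncomputable def expAd {𝔤 : Type*} [LieRing 𝔤] [LieAlgebra ℝ 𝔤] (X : 𝔤) : Module.End ℝ 𝔤 :=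
  ∑ i ∈ Finset.range (nilpotencyClass (LieAlgebra.ad ℝ 𝔤 X)),
    ((Nat.factorial i : ℝ)⁻¹) • (LieAlgebra.ad ℝ 𝔤 X) ^ i

/-- The adjoint group `Ad(G)` of a nilpotent real Lie algebra, `G` being a connected Lie group with
this Lie algebra: it is generated by the operators `exp (ad X)`. Since `exp (ad (-X))` is the inverse
of `exp (ad X)`, the submonoid that they generate is a group. -/
def adjointGroup (𝔤 : Type*) [LieRing 𝔤] [LieAlgebra ℝ 𝔤] : Submonoid (Module.End ℝ 𝔤) :=
  Submonoid.closure (Set.range (fun X : 𝔤 => expAd X))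

/-- The coadjoint orbit `{ξ ∘ Ad(g)⁻¹ | g ∈ G}`. Since `Ad(G)` is closed under inverses, it is
`{ξ ∘ φ | φ ∈ Ad(G)}`. -/
def coadjointOrbit {𝔤 : Type*} [LieRing 𝔤] [LieAlgebra ℝ 𝔤] (ξ : Module.Dual ℝ 𝔤) :
    Set (Module.Dual ℝ 𝔤) :=
  {η | ∃ φ ∈ adjointGroup 𝔤, η = ξ.comp φ}

/-- The bilinear form `B_ξ(X, Y) = ξ([X, Y])`. -/
noncomputable def kirillovForm {𝔤 : Type*} [LieRing 𝔤] [LieAlgebra ℝ 𝔤] (ξ : Module.Dual ℝ 𝔤) :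
    LinearMap.BilinForm ℝ 𝔤 :=
  LinearMap.mk₂ ℝ (fun X Y => ξ ⁅X, Y⁆)
    (fun X X' Y => by rw [add_lie, map_add])
    (fun c X Y => by rw [smul_lie, map_smul])
    (fun X Y Y' => by rw [lie_add, map_add])
    (fun c X Y => by rw [lie_smul, map_smul])

/-- The dimension of the coadjoint orbit of `ξ`, as that of its tangent space at `ξ`: this space
consists of the functionals `Y ↦ -ξ([X, Y])` with `X ∈ 𝔤`. -/
noncomputable def coadjointOrbitDim {𝔤 : Type*} [LieRing 𝔤] [LieAlgebra ℝ 𝔤]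
    (ξ : Module.Dual ℝ 𝔤) : ℕ :=
  Module.finrank ℝ (LinearMap.range (kirillovForm ξ))

/-- The coadjoint orbit of `ξ` is generic: it has the maximal dimension among all coadjoint
orbits. -/
def HasGenericOrbit {𝔤 : Type*} [LieRing 𝔤] [LieAlgebra ℝ 𝔤] (ξ : Module.Dual ℝ 𝔤) : Prop :=
  ∀ η : Module.Dual ℝ 𝔤, coadjointOrbitDim η ≤ coadjointOrbitDim ξ

/-- A subset of a real vector space is flat if it is an affine subspace. -/
def IsFlat {V : Type*} [AddCommGroup V] [Module ℝ V] (O : Set V) : Prop :=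
  ∃ S : AffineSubspace ℝ V, (S : Set V) = O

/-- All generic coadjoint orbits are flat. -/
def HasFlatGenericCoadjointOrbits (𝔤 : Type*) [LieRing 𝔤] [LieAlgebra ℝ 𝔤] : Prop :=
  ∀ ξ : Module.Dual ℝ 𝔤, HasGenericOrbit ξ → IsFlat (coadjointOrbit ξ)

/-- The linear subspace `W` is isotropic for `B_ξ`, that is, `ξ([W, W]) = 0`. -/
def IsIsotropicFor {𝔤 : Type*} [LieRing 𝔤] [LieAlgebra ℝ 𝔤] (ξ : Module.Dual ℝ 𝔤)
    (W : Submodule ℝ 𝔤) : Prop :=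
  ∀ X ∈ W, ∀ Y ∈ W, kirillovForm ξ X Y = 0

/-- A polarization at `ξ`: a subalgebra which is maximal among the linear subspaces that are
isotropic for `B_ξ`. -/
def IsPolarization {𝔤 : Type*} [LieRing 𝔤] [LieAlgebra ℝ 𝔤] (ξ : Module.Dual ℝ 𝔤)
    (𝔭 : LieSubalgebra ℝ 𝔤) : Prop :=
  Maximal (IsIsotropicFor ξ) 𝔭.toSubmodule

/-!
Let `𝔨` be 3-step nilpotent with one-dimensional center `𝔷`, and let `C` be its second center.
Then `[𝔨, C] ⊆ 𝔷`, `[𝔨, 𝔨] ⊆ C` and, by the Jacobi identity, `[C, [𝔨, 𝔨]] = 0`; moreover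
`C ≠ 𝔨` and `C ⊄ 𝔷`. Everything rests on the elementary remark that, for `X ∈ C`, the element
`[Y, X]` is central, so that it vanishes as soon as `ξ([Y, X]) = 0` for some `ξ` not vanishing
on `𝔷`.

Suppose that `C` is maximal abelian. If `ξ` does not vanish on `𝔷`, the remark shows that `C` is
its own orthogonal for `B_ξ` (`isPolarization_of_isMaximalAbelian`), hence that the radical of
`B_ξ` is `𝔷` (`kirillovForm_ker_eq_center`). So the generic `ξ` are those not vanishing on `𝔷`
(`HasGenericOrbit.exists_center_ne_zero`). The orbit of such a `ξ` is the affine space of all `η`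
which agree with `ξ` on `𝔷` (`mem_coadjointOrbit_of_eqOn_center`): every functional vanishing on
`𝔷` is some `B_ξ(Y, ·)`, and since `exp (ad Y)` is `1 + ad Y` on `C`, one exponential makes `ξ`
agree with `η` on `C`; the difference left over is `B_ξ(Y, ·)` with `Y ∈ C^⊥ = C`, and
`exp (ad Y) = 1 + ad Y` for such `Y`, so a second exponential finishes.

Conversely, a single generic `ξ` at which `C` is a polarization suffices
(`isMaximalAbelian_of_isPolarization`). It cannot vanish on `𝔷`: otherwise `C` would lie in the
radical of `B_ξ`, and a maximal isotropic subspace inside the radical is everything. Hence `C`,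
being isotropic, is abelian by the remark, and any abelian subalgebra containing it is isotropic,
hence equal to it.
-/

/-! ### Three-step nilpotent Lie algebras and their second center -/

section SecondCenter

variable {K 𝔤 : Type*} [Field K] [LieRing 𝔤] [LieAlgebra K 𝔤]

lemma mem_center_iff_lie {X : 𝔤} : X ∈ LieAlgebra.center K 𝔤 ↔ ∀ Y : 𝔤, ⁅Y, X⁆ = 0 :=
  LieModule.mem_maxTrivSubmodule K 𝔤 𝔤 X

lemma lie_mem_center_of_mem_secondCenter {X : 𝔤} (hX : X ∈ secondCenterSubalgebra K 𝔤) (Y : 𝔤) :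
    ⁅Y, X⁆ ∈ LieAlgebra.center K 𝔤 :=
  mem_center_iff_lie.2 fun Z => hX Z Y

lemma lie_mem_center_of_mem_secondCenter' {X : 𝔤} (hX : X ∈ secondCenterSubalgebra K 𝔤) (Y : 𝔤) :
    ⁅X, Y⁆ ∈ LieAlgebra.center K 𝔤 := by
  rw [← lie_skew]
  exact neg_mem (lie_mem_center_of_mem_secondCenter hX Y)

lemma mem_secondCenter_of_mem_center {X : 𝔤} (hX : X ∈ LieAlgebra.center K 𝔤) :
    X ∈ secondCenterSubalgebra K 𝔤 := fun Y Z => by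
  rw [mem_center_iff_lie.1 hX Z, lie_zero]

/-- The second center commutes with the derived algebra, by the Jacobi identity. -/
lemma lie_lie_eq_zero_of_mem_secondCenter {X : 𝔤} (hX : X ∈ secondCenterSubalgebra K 𝔤)
    (Y Z : 𝔤) : ⁅X, ⁅Y, Z⁆⁆ = 0 := by
  rw [leibniz_lie, ← lie_skew X Y, neg_lie, ← lie_skew X Z, lie_neg, ← lie_skew ⁅Y, X⁆ Z,
    hX Z Y, hX Y Z]
  simp

lemma LieSubalgebra.isLieAbelian_iff_lie_eq_zero {𝔞 : LieSubalgebra K 𝔤} :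
    IsLieAbelian 𝔞 ↔ ∀ x ∈ 𝔞, ∀ y ∈ 𝔞, ⁅x, y⁆ = 0 := by
  constructor
  · intro h x hx y hy
    simpa using congrArg Subtype.val (h.trivial ⟨x, hx⟩ ⟨y, hy⟩)
  · intro h
    exact ⟨fun x y => Subtype.ext (by simpa using h x x.2 y y.2)⟩

/-- A maximal abelian subalgebra is its own centralizer. -/
lemma IsMaximalAbelian.mem_of_commutes {𝔪 : LieSubalgebra K 𝔤} (h𝔪 : IsMaximalAbelian 𝔪) {X : 𝔤}
    (hX : ∀ Y ∈ 𝔪, ⁅X, Y⁆ = 0) : X ∈ 𝔪 := by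
  have hab := LieSubalgebra.isLieAbelian_iff_lie_eq_zero.1 h𝔪.prop
  have key : ∀ x ∈ 𝔪.toSubmodule ⊔ K ∙ X, ∀ y ∈ 𝔪.toSubmodule ⊔ K ∙ X, ⁅x, y⁆ = 0 := by
    intro x hx y hy
    obtain ⟨a, ha, x', hx', rfl⟩ := Submodule.mem_sup.1 hx
    obtain ⟨b, hb, y', hy', rfl⟩ := Submodule.mem_sup.1 hy
    obtain ⟨s, rfl⟩ := Submodule.mem_span_singleton.1 hx'
    obtain ⟨t, rfl⟩ := Submodule.mem_span_singleton.1 hy'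
    have haX : ⁅a, X⁆ = 0 := by rw [← lie_skew, hX a ha, neg_zero]
    simp [hab a ha b hb, haX, hX b hb]
  let 𝔞 : LieSubalgebra K 𝔤 :=
    { (𝔪.toSubmodule ⊔ K ∙ X) with
      lie_mem' := fun {x y} hx hy => by
        rw [key x hx y hy]
        exact (𝔪.toSubmodule ⊔ K ∙ X).zero_mem }
  have h𝔞 : IsLieAbelian 𝔞 := LieSubalgebra.isLieAbelian_iff_lie_eq_zero.2 key
  have hle : 𝔪 ≤ 𝔞 := fun x hx => Submodule.mem_sup_left (S := 𝔪.toSubmodule) hx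
  exact h𝔪.le_of_ge h𝔞 hle
    (Submodule.mem_sup_right (S := 𝔪.toSubmodule) (Submodule.mem_span_singleton_self X))

variable (K) in
lemma lie_mem_secondCenter_of_nilpotencyLength
    (hstep : LieModule.nilpotencyLength 𝔤 𝔤 = 3) (X Y : 𝔤) :
    ⁅X, Y⁆ ∈ secondCenterSubalgebra K 𝔤 := by
  intro U V
  have h := ((LieModule.nilpotencyLength_eq_succ_iff K 𝔤 𝔤 2).1 hstep).1
  rw [← LieSubmodule.mem_bot (R := K) (L := 𝔤), ← h]
  simp only [LieModule.lowerCentralSeries_succ, LieModule.lowerCentralSeries_zero]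
  exact LieSubmodule.lie_mem_lie (LieSubmodule.mem_top U)
    (LieSubmodule.lie_mem_lie (LieSubmodule.mem_top V)
      (LieSubmodule.lie_mem_lie (LieSubmodule.mem_top X) (LieSubmodule.mem_top Y)))

variable (K) in
lemma exists_notMem_secondCenter (hstep : LieModule.nilpotencyLength 𝔤 𝔤 = 3) :
    ∃ X : 𝔤, X ∉ secondCenterSubalgebra K 𝔤 := by
  by_contra! hall
  refine ((LieModule.nilpotencyLength_eq_succ_iff K 𝔤 𝔤 2).1 hstep).2 ?_
  rw [LieModule.lowerCentralSeries_succ, ← LieModule.le_max_triv_iff_bracket_eq_bot,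
    LieModule.lowerCentralSeries_succ, LieSubmodule.lieIdeal_oper_eq_span,
    LieSubmodule.lieSpan_le]
  rintro _ ⟨Y, Z, rfl⟩
  exact lie_mem_center_of_mem_secondCenter (hall Z) Y

lemma exists_mem_secondCenter_notMem_center (hstep : LieModule.nilpotencyLength 𝔤 𝔤 = 3) :
    ∃ X ∈ secondCenterSubalgebra K 𝔤, X ∉ LieAlgebra.center K 𝔤 := by
  by_contra! hall
  obtain ⟨X, hX⟩ := exists_notMem_secondCenter K hstep
  exact hX fun Y Z => mem_center_iff_lie.1
    (hall _ (lie_mem_secondCenter_of_nilpotencyLength K hstep Z X)) Y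

/-- On a one-dimensional center, a functional not vanishing identically is injective. -/
lemma eq_zero_of_mem_center (hcenter : Module.finrank K (LieAlgebra.center K 𝔤) = 1)
    {ξ : Module.Dual K 𝔤} {Z : 𝔤} (hZ : Z ∈ LieAlgebra.center K 𝔤) (hξ : ξ Z ≠ 0) {c : 𝔤}
    (hc : c ∈ LieAlgebra.center K 𝔤) (hc0 : ξ c = 0) : c = 0 := by
  have hZ0 : (⟨Z, hZ⟩ : LieAlgebra.center K 𝔤) ≠ 0 := fun h => hξ (by
    rw [show Z = 0 from congrArg Subtype.val h, map_zero])
  obtain ⟨t, ht⟩ := (finrank_eq_one_iff_of_nonzero' _ hZ0).1 hcenter ⟨c, hc⟩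
  have ht' : t • Z = c := congrArg Subtype.val ht
  rw [← ht', map_smul, smul_eq_mul] at hc0
  rw [← ht', (mul_eq_zero.1 hc0).resolve_right hξ, zero_smul]

end SecondCenter

/-! ### Exponentials and coadjoint orbits -/

section Orbit

variable {𝔤 : Type*} [LieRing 𝔤] [LieAlgebra ℝ 𝔤]

lemma kirillovForm_apply (ξ : Module.Dual ℝ 𝔤) (X Y : 𝔤) : kirillovForm ξ X Y = ξ ⁅X, Y⁆ :=
  rfl

lemma mem_ker_kirillovForm {ξ : Module.Dual ℝ 𝔤} {X : 𝔤} :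
    X ∈ LinearMap.ker (kirillovForm ξ) ↔ ∀ Y : 𝔤, ξ ⁅X, Y⁆ = 0 := by
  rw [LinearMap.mem_ker, LinearMap.ext_iff]
  rfl

/-- If `ad X` is nilpotent, any number of terms beyond its nilpotency class gives `exp (ad X)`. -/
lemma expAd_eq_sum_range {X : 𝔤} {n : ℕ} (h : LieAlgebra.ad ℝ 𝔤 X ^ n = 0) :
    expAd X = ∑ i ∈ Finset.range n, ((Nat.factorial i : ℝ)⁻¹) • LieAlgebra.ad ℝ 𝔤 X ^ i := by
  refine Finset.sum_subset (Finset.range_mono (Nat.sInf_le h)) fun i _ hi => ?_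
  rw [pow_eq_zero_of_le (by simpa using hi) (pow_nilpotencyClass ⟨n, h⟩), smul_zero]

lemma expAd_apply (hstep : LieModule.nilpotencyLength 𝔤 𝔤 = 3) (X W : 𝔤) :
    expAd X W = W + ⁅X, W⁆ + (2 : ℝ)⁻¹ • ⁅X, ⁅X, W⁆⁆ := by
  have h : LieAlgebra.ad ℝ 𝔤 X ^ 3 = 0 := by
    ext W
    simpa [pow_succ] using lie_mem_secondCenter_of_nilpotencyLength ℝ hstep X W X X
  rw [expAd_eq_sum_range h]
  simp [Finset.sum_range_succ, pow_succ]

lemma apply_eq_of_mem_coadjointOrbit (hstep : LieModule.nilpotencyLength 𝔤 𝔤 = 3)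
    {ξ η : Module.Dual ℝ 𝔤} (hη : η ∈ coadjointOrbit ξ) {Z : 𝔤}
    (hZ : Z ∈ LieAlgebra.center ℝ 𝔤) : η Z = ξ Z := by
  obtain ⟨φ, hφ, rfl⟩ := hη
  have hfix : φ Z = Z := by
    induction hφ using Submonoid.closure_induction with
    | mem φ h =>
      obtain ⟨X, rfl⟩ := h
      simp [expAd_apply hstep, mem_center_iff_lie.1 hZ X]
    | one => rfl
    | mul φ ψ _ _ h₁ h₂ => rw [Module.End.mul_apply, h₂, h₁]
  rw [LinearMap.comp_apply, hfix]

lemma expAd_mem_adjointGroup (X : 𝔤) : expAd X ∈ adjointGroup 𝔤 :=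
  Submonoid.subset_closure ⟨X, rfl⟩

end Orbit

/-! ### Functionals not vanishing on the center -/

section MaximalAbelian

variable {𝔤 : Type*} [LieRing 𝔤] [LieAlgebra ℝ 𝔤]

/-- For `ξ` nonzero on the center, a maximal abelian second center contains its own orthogonal with
respect to `B_ξ`. -/
lemma mem_secondCenter_of_orthogonal (hcenter : Module.finrank ℝ (LieAlgebra.center ℝ 𝔤) = 1)
    (hmax : IsMaximalAbelian (secondCenterSubalgebra ℝ 𝔤)) {ξ : Module.Dual ℝ 𝔤} {Z : 𝔤}
    (hZ : Z ∈ LieAlgebra.center ℝ 𝔤) (hξ : ξ Z ≠ 0) {X : 𝔤}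
    (hX : ∀ Y ∈ secondCenterSubalgebra ℝ 𝔤, ξ ⁅X, Y⁆ = 0) :
    X ∈ secondCenterSubalgebra ℝ 𝔤 :=
  hmax.mem_of_commutes fun Y hY =>
    eq_zero_of_mem_center hcenter hZ hξ (lie_mem_center_of_mem_secondCenter hY X) (hX Y hY)

lemma isPolarization_of_isMaximalAbelian
    (hcenter : Module.finrank ℝ (LieAlgebra.center ℝ 𝔤) = 1)
    (hmax : IsMaximalAbelian (secondCenterSubalgebra ℝ 𝔤)) {ξ : Module.Dual ℝ 𝔤} {Z : 𝔤}
    (hZ : Z ∈ LieAlgebra.center ℝ 𝔤) (hξ : ξ Z ≠ 0) :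
    IsPolarization ξ (secondCenterSubalgebra ℝ 𝔤) := by
  refine ⟨fun X hX Y hY => ?_, fun W hW hle X hX => ?_⟩
  · rw [kirillovForm_apply, LieSubalgebra.isLieAbelian_iff_lie_eq_zero.1 hmax.prop X hX Y hY,
      map_zero]
  · exact mem_secondCenter_of_orthogonal hcenter hmax hZ hξ fun Y hY => hW X hX Y (hle hY)

lemma center_le_ker_kirillovForm (ξ : Module.Dual ℝ 𝔤) :
    (LieAlgebra.center ℝ 𝔤).toSubmodule ≤ LinearMap.ker (kirillovForm ξ) := fun X hX => by
  refine mem_ker_kirillovForm.2 fun Y => ?_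
  rw [← lie_skew, mem_center_iff_lie.1 hX Y, neg_zero, map_zero]

lemma kirillovForm_ker_eq_center (hcenter : Module.finrank ℝ (LieAlgebra.center ℝ 𝔤) = 1)
    (hmax : IsMaximalAbelian (secondCenterSubalgebra ℝ 𝔤)) {ξ : Module.Dual ℝ 𝔤} {Z : 𝔤}
    (hZ : Z ∈ LieAlgebra.center ℝ 𝔤) (hξ : ξ Z ≠ 0) :
    LinearMap.ker (kirillovForm ξ) = (LieAlgebra.center ℝ 𝔤).toSubmodule := by
  refine le_antisymm (fun X hX => ?_) (center_le_ker_kirillovForm ξ)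
  rw [mem_ker_kirillovForm] at hX
  have hXC : X ∈ secondCenterSubalgebra ℝ 𝔤 :=
    mem_secondCenter_of_orthogonal hcenter hmax hZ hξ fun Y _ => hX Y
  refine mem_center_iff_lie.2 fun Y => ?_
  rw [← lie_skew, eq_zero_of_mem_center hcenter hZ hξ
    (lie_mem_center_of_mem_secondCenter' hXC Y) (hX Y), neg_zero]

variable [FiniteDimensional ℝ 𝔤]

lemma HasGenericOrbit.finrank_ker_le {ξ : Module.Dual ℝ 𝔤} (hξ : HasGenericOrbit ξ)
    (η : Module.Dual ℝ 𝔤) :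
    Module.finrank ℝ (LinearMap.ker (kirillovForm ξ)) ≤
      Module.finrank ℝ (LinearMap.ker (kirillovForm η)) := by
  have h₁ := LinearMap.finrank_range_add_finrank_ker (kirillovForm ξ)
  have h₂ := LinearMap.finrank_range_add_finrank_ker (kirillovForm η)
  have h₃ : Module.finrank ℝ (LinearMap.range (kirillovForm η)) ≤
    Module.finrank ℝ (LinearMap.range (kirillovForm ξ)) := hξ η
  lia

lemma exists_hasGenericOrbit : ∃ ξ : Module.Dual ℝ 𝔤, HasGenericOrbit ξ := by
  have hbdd : BddAbove (Set.range (coadjointOrbitDim (𝔤 := 𝔤))) :=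
    ⟨Module.finrank ℝ 𝔤, by rintro _ ⟨ξ, rfl⟩; exact LinearMap.finrank_range_le _⟩
  obtain ⟨ξ, hξ⟩ := Nat.sSup_mem (Set.range_nonempty _) hbdd
  exact ⟨ξ, fun η => hξ ▸ le_csSup hbdd ⟨η, rfl⟩⟩

/-- A generic functional does not vanish on the center: otherwise the second center, which is larger
than the center, would lie in the radical of `B_ξ`, while some radicals are equal to the center. -/
lemma HasGenericOrbit.exists_center_ne_zero
    (hstep : LieModule.nilpotencyLength 𝔤 𝔤 = 3)
    (hcenter : Module.finrank ℝ (LieAlgebra.center ℝ 𝔤) = 1)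
    (hmax : IsMaximalAbelian (secondCenterSubalgebra ℝ 𝔤)) {ξ : Module.Dual ℝ 𝔤}
    (hξ : HasGenericOrbit ξ) : ∃ Z ∈ LieAlgebra.center ℝ 𝔤, ξ Z ≠ 0 := by
  by_contra! hzero
  obtain ⟨⟨Z, hZ⟩, hZ0, -⟩ := finrank_eq_one_iff'.1 hcenter
  obtain ⟨η, hη⟩ : ∃ η : Module.Dual ℝ 𝔤, η Z ≠ 0 := by
    by_contra! h
    exact hZ0 (Subtype.ext ((Module.forall_dual_apply_eq_zero_iff ℝ Z).1 h))
  have hker := hξ.finrank_ker_le η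
  rw [kirillovForm_ker_eq_center hcenter hmax hZ hη] at hker
  have heq := Submodule.eq_of_le_of_finrank_le (center_le_ker_kirillovForm ξ) hker
  obtain ⟨X, hXC, hX⟩ := exists_mem_secondCenter_notMem_center (K := ℝ) hstep
  refine hX ?_
  rw [← LieSubmodule.mem_toSubmodule, heq, mem_ker_kirillovForm]
  exact fun Y => hzero _ (lie_mem_center_of_mem_secondCenter' hXC Y)

lemma exists_kirillovForm_eq (hcenter : Module.finrank ℝ (LieAlgebra.center ℝ 𝔤) = 1)
    (hmax : IsMaximalAbelian (secondCenterSubalgebra ℝ 𝔤)) {ξ : Module.Dual ℝ 𝔤} {Z : 𝔤}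
    (hZ : Z ∈ LieAlgebra.center ℝ 𝔤) (hξ : ξ Z ≠ 0) {θ : Module.Dual ℝ 𝔤}
    (hθ : ∀ c ∈ LieAlgebra.center ℝ 𝔤, θ c = 0) : ∃ Y : 𝔤, ∀ X : 𝔤, ξ ⁅Y, X⁆ = θ X := by
  have hle : LinearMap.range (kirillovForm ξ) ≤
      (LieAlgebra.center ℝ 𝔤).toSubmodule.dualAnnihilator := by
    rintro _ ⟨Y, rfl⟩
    refine (Submodule.mem_dualAnnihilator _).2 fun c hc => ?_
    rw [kirillovForm_apply, mem_center_iff_lie.1 hc Y, map_zero]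
  have h₁ := LinearMap.finrank_range_add_finrank_ker (kirillovForm ξ)
  have h₂ := Subspace.finrank_add_finrank_dualAnnihilator_eq
    (LieAlgebra.center ℝ 𝔤).toSubmodule
  rw [kirillovForm_ker_eq_center hcenter hmax hZ hξ] at h₁
  have heq := Submodule.eq_of_le_of_finrank_le hle (by lia)
  obtain ⟨Y, hY⟩ : θ ∈ LinearMap.range (kirillovForm ξ) := by
    rw [heq]
    exact (Submodule.mem_dualAnnihilator _).2 hθ
  exact ⟨Y, fun X => LinearMap.congr_fun hY X⟩

/-- If `ξ` is nonzero on the center, its orbit contains every functional which agrees with it there.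
Two exponentials are needed: one for the values on the second center, one for the remaining
values. -/
lemma mem_coadjointOrbit_of_eqOn_center (hstep : LieModule.nilpotencyLength 𝔤 𝔤 = 3)
    (hcenter : Module.finrank ℝ (LieAlgebra.center ℝ 𝔤) = 1)
    (hmax : IsMaximalAbelian (secondCenterSubalgebra ℝ 𝔤)) {ξ η : Module.Dual ℝ 𝔤} {Z : 𝔤}
    (hZ : Z ∈ LieAlgebra.center ℝ 𝔤) (hξ : ξ Z ≠ 0)
    (hη : ∀ c ∈ LieAlgebra.center ℝ 𝔤, η c = ξ c) : η ∈ coadjointOrbit ξ := by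
  obtain ⟨Y, hY⟩ := exists_kirillovForm_eq hcenter hmax hZ hξ (θ := η - ξ)
    fun c hc => by rw [LinearMap.sub_apply, hη c hc, sub_self]
  set ξ' : Module.Dual ℝ 𝔤 := ξ.comp (expAd Y) with hξ'
  have hC : ∀ X ∈ secondCenterSubalgebra ℝ 𝔤, ξ' X = η X := fun X hX => by
    simp [hξ', expAd_apply hstep, hX Y Y, hY]
  have hz : ∀ c ∈ LieAlgebra.center ℝ 𝔤, ξ' c = η c := fun c hc =>
    hC c (mem_secondCenter_of_mem_center hc)
  have hξ'Z : ξ' Z ≠ 0 := by rwa [hz Z hZ, hη Z hZ]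
  obtain ⟨U, hU⟩ := exists_kirillovForm_eq hcenter hmax hZ hξ'Z (θ := η - ξ')
    fun c hc => by rw [LinearMap.sub_apply, hz c hc, sub_self]
  have hUC : U ∈ secondCenterSubalgebra ℝ 𝔤 :=
    mem_secondCenter_of_orthogonal hcenter hmax hZ hξ'Z fun X hX => by
      rw [hU, LinearMap.sub_apply, hC X hX, sub_self]
  refine ⟨expAd Y * expAd U, mul_mem (expAd_mem_adjointGroup Y) (expAd_mem_adjointGroup U), ?_⟩
  ext X
  have hX : ξ' (expAd U X) = η X := by
    rw [expAd_apply hstep, lie_lie_eq_zero_of_mem_secondCenter hUC, smul_zero, add_zero, map_add,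
      hU, LinearMap.sub_apply, add_sub_cancel]
  rw [← hX]
  rfl

lemma isFlat_coadjointOrbit (hstep : LieModule.nilpotencyLength 𝔤 𝔤 = 3)
    (hcenter : Module.finrank ℝ (LieAlgebra.center ℝ 𝔤) = 1)
    (hmax : IsMaximalAbelian (secondCenterSubalgebra ℝ 𝔤)) {ξ : Module.Dual ℝ 𝔤} {Z : 𝔤}
    (hZ : Z ∈ LieAlgebra.center ℝ 𝔤) (hξ : ξ Z ≠ 0) : IsFlat (coadjointOrbit ξ) := by
  refine ⟨AffineSubspace.mk' ξ (LieAlgebra.center ℝ 𝔤).toSubmodule.dualAnnihilator, ?_⟩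
  ext η
  rw [SetLike.mem_coe, AffineSubspace.mem_mk', vsub_eq_sub, Submodule.mem_dualAnnihilator]
  simp only [LinearMap.sub_apply, sub_eq_zero]
  exact ⟨fun h => mem_coadjointOrbit_of_eqOn_center hstep hcenter hmax hZ hξ h,
    fun h c hc => apply_eq_of_mem_coadjointOrbit hstep h hc⟩

end MaximalAbelian

/-! ### From polarizations to maximal abelian subalgebras -/

lemma isMaximalAbelian_of_isPolarization {𝔤 : Type*} [LieRing 𝔤] [LieAlgebra ℝ 𝔤]
    (hstep : LieModule.nilpotencyLength 𝔤 𝔤 = 3)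
    (hcenter : Module.finrank ℝ (LieAlgebra.center ℝ 𝔤) = 1) {ξ : Module.Dual ℝ 𝔤}
    (hpol : IsPolarization ξ (secondCenterSubalgebra ℝ 𝔤)) :
    IsMaximalAbelian (secondCenterSubalgebra ℝ 𝔤) := by
  obtain ⟨Z, hZ, hξ⟩ : ∃ Z ∈ LieAlgebra.center ℝ 𝔤, ξ Z ≠ 0 := by
    by_contra! hzero
    obtain ⟨X, hX⟩ := exists_notMem_secondCenter ℝ hstep
    -- If `ξ` vanishes on the center, then adding any line to the second center keeps it isotropic.
    have hiso : IsIsotropicFor ξ ((secondCenterSubalgebra ℝ 𝔤).toSubmodule ⊔ ℝ ∙ X) := by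
      intro x hx y hy
      obtain ⟨a, ha, x', hx', rfl⟩ := Submodule.mem_sup.1 hx
      obtain ⟨b, hb, y', hy', rfl⟩ := Submodule.mem_sup.1 hy
      obtain ⟨s, rfl⟩ := Submodule.mem_span_singleton.1 hx'
      obtain ⟨t, rfl⟩ := Submodule.mem_span_singleton.1 hy'
      have h₁ := hzero _ (lie_mem_center_of_mem_secondCenter' ha (b + t • X))
      have h₂ := hzero _ (lie_mem_center_of_mem_secondCenter hb (s • X))
      rw [kirillovForm_apply, add_lie, map_add, h₁, lie_add, map_add, h₂]
      simp
    exact hX (hpol.le_of_ge hiso le_sup_left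
      (Submodule.mem_sup_right (Submodule.mem_span_singleton_self X)))
  refine ⟨LieSubalgebra.isLieAbelian_iff_lie_eq_zero.2 fun X hX Y hY => ?_, fun 𝔞 h𝔞 hle => ?_⟩
  · exact eq_zero_of_mem_center hcenter hZ hξ (lie_mem_center_of_mem_secondCenter hY X)
      (hpol.prop X hX Y hY)
  · refine hpol.le_of_ge (y := 𝔞.toSubmodule) (fun X hX Y hY => ?_) hle
    rw [kirillovForm_apply, LieSubalgebra.isLieAbelian_iff_lie_eq_zero.1 h𝔞 X hX Y hY, map_zero]

theorem corollary5p3 {𝔨 : Type*} [LieRing 𝔨] [LieAlgebra ℝ 𝔨] [FiniteDimensional ℝ 𝔨]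
    (hnil : LieRing.IsNilpotent 𝔨) (hstep : LieModule.nilpotencyLength 𝔨 𝔨 = 3)
    (hcenter : Module.finrank ℝ (LieAlgebra.center ℝ 𝔨) = 1) :
    IsTypeAPlus ℝ 𝔨 ↔
      HasFlatGenericCoadjointOrbits 𝔨 ∧
        ∀ ξ : Module.Dual ℝ 𝔨, HasGenericOrbit ξ →
          ∀ η ∈ coadjointOrbit ξ, IsPolarization η (secondCenterSubalgebra ℝ 𝔨) := by
  constructor
  · rintro ⟨-, -, hmax | htop⟩
    · refine ⟨fun ξ hgen => ?_, fun ξ hgen η hη => ?_⟩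
      · obtain ⟨Z, hZ, hξ⟩ := hgen.exists_center_ne_zero hstep hcenter hmax
        exact isFlat_coadjointOrbit hstep hcenter hmax hZ hξ
      · obtain ⟨Z, hZ, hξ⟩ := hgen.exists_center_ne_zero hstep hcenter hmax
        refine isPolarization_of_isMaximalAbelian hcenter hmax hZ ?_
        rwa [apply_eq_of_mem_coadjointOrbit hstep hη hZ]
    · -- In a 3-step nilpotent Lie algebra the second center is a proper ideal.
      obtain ⟨X, hX⟩ := exists_notMem_secondCenter ℝ hstep
      exact absurd (htop ▸ LieSubalgebra.mem_top X) hX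
  · rintro ⟨-, hpol⟩
    obtain ⟨ξ, hgen⟩ := exists_hasGenericOrbit (𝔤 := 𝔨)
    exact ⟨hnil, hcenter, Or.inl <| isMaximalAbelian_of_isPolarization hstep hcenter <|
      hpol ξ hgen ξ ⟨1, one_mem _, rfl⟩⟩
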